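/- For a rational number $x$ and an integer $n\ge 0$ let $(x)_n=x(x+1)\cdots(x+n-1)$ denote the shifted factorial (with $(x)_0=1$). For a prime $p$ and rational numbers $a,b$, write $a\equiv b\pmod{p^6}$ if $a-b=p^6c$ for some rational number $c$ whose reduced denominator is not divisible by $p$. Let $p\equiv 1\pmod 6$ be a prime. Then $$\sum_{\substack{i,j,k\ge 0\\ i+j+k\le p-1}}(6i+1)(6j+1)(6k+1)\frac{(\frac13)_i^6(\frac13)_j^6(\frac13)_k^6}{(1)_i^6(1)_j^6(1)_k^6}$$ $$\equiv p^3\,\frac{(\frac23)_{(p-1)/3}^3}{(1)_{(p-1)/3}^3}\left\{\sum_{k=0}^{(p-1)/3}\frac{(\frac13)_k^3}{(1)_k^3}\right\}^2\sum_{k=0}^{(p-1)/3}\frac{(\frac13)_k^3}{(1)_k^3}\left\{1-3p^2\sum_{t=1}^{k}\left(\frac1{(3t-2)^2}+\frac1{(3t)^2}\right)\right\}\pmod{p^6}.$$ -/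

import Mathlib

/-- The shifted factorial `(x)_n = x (x + 1) ⋯ (x + n - 1)` of a rational number `x`, with
`(x)_0 = 1`. For `x > 0` it equals `Γ(x + n) / Γ(x)`. -/
noncomputable def shiftedFactorial (x : ℚ) (n : ℕ) : ℚ :=
  (ascPochhammer ℚ n).eval x

/-- The congruence `a ≡ b (mod p ^ e)` of rational numbers, for a prime `p`: the difference
`a - b` is `p ^ e` times a rational number whose reduced denominator is prime to `p`. -/
def RatModEqPow (p e : ℕ) (a b : ℚ) : Prop :=
  ∃ c : ℚ, ¬ p ∣ c.den ∧ a - b = (p : ℚ) ^ e * c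

/-! Write `p = 3n + 1` and `u_k = (1/3)_k / (1)_k`. For `n < k < p` the factor `1/3 + n = p/3` of
`(1/3)_k` makes `u_k` divisible by `p`, so `u_k ^ 6` vanishes mod `p ^ 6`. Since `3n = p - 1`, the
box `[0, n]^3` lies in the simplex, and the triple sum is congruent to `S ^ 3` with `S = ∑_{k ≤ n}
(6k + 1) u_k ^ 6` (`ratModEqPow_sum_simplex`).

It remains to find `S` mod `p ^ 4`: as the value found is a multiple of `p`, cubing raises the
precision to `p ^ 6` (`ratModEqPow_cube`). Four of the six copies of `1/3` are shifted to `(1 ±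
p)/3` and `(1 ± ip)/3`, with matching shifts below; only `p ^ 4` enters, so `S` is unchanged mod `p
^ 4`. Since `(1 - p)/3 = -n`, the deformed very-well-poised series terminates, and
`sum_wellPoised_eq` turns it exactly into `p` times `(2/3)_n / (1)_n` times a `₃F₂`, whose terms are
expanded to order `p ^ 2` in `ratModEqPow_quadratic_prod`.

The transformation is a Bailey-type argument: expand each `₃F₂` term by a summable well-poised
series (`sum_wellPoisedTerm`), interchange the sums, and evaluate the inner balanced sum
(`sum_balancedTerm`). -/

lemma shiftedFactorial_zero (x : ℚ) : shiftedFactorial x 0 = 1 := by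
  simp [shiftedFactorial]

lemma shiftedFactorial_succ (x : ℚ) (n : ℕ) :
    shiftedFactorial x (n + 1) = shiftedFactorial x n * (x + n) := by
  simp [shiftedFactorial, ascPochhammer_succ_eval]

lemma shiftedFactorial_succ_left (x : ℚ) (n : ℕ) :
    shiftedFactorial x (n + 1) = x * shiftedFactorial (x + 1) n := by
  simp [shiftedFactorial, ascPochhammer_succ_left, Polynomial.eval_comp]

lemma shiftedFactorial_pos {x : ℚ} (hx : 0 < x) (n : ℕ) : 0 < shiftedFactorial x n :=
  ascPochhammer_pos n x hx

lemma shiftedFactorial_eq_prod (x : ℚ) (n : ℕ) :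
    shiftedFactorial x n = ∏ j ∈ Finset.range n, (x + j) := by
  induction n with
  | zero => simp [shiftedFactorial_zero]
  | succ n ih => rw [shiftedFactorial_succ, Finset.prod_range_succ, ih]

lemma shiftedFactorial_neg_of_lt {n k : ℕ} (h : n < k) : shiftedFactorial (-(n : ℚ)) k = 0 := by
  rw [shiftedFactorial_eq_prod]
  exact Finset.prod_eq_zero (Finset.mem_range.2 h) (by ring)

/-! ### A terminating very-well-poised sum -/

/-- The quadratic analogue `∏ j < n, ((x + j) ^ 2 + y)` of the shifted factorial. -/
noncomputable def quadraticFactorial (x y : ℚ) (n : ℕ) : ℚ :=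
  ∏ j ∈ Finset.range n, ((x + j) ^ 2 + y)

lemma quadraticFactorial_zero (x y : ℚ) : quadraticFactorial x y 0 = 1 := by
  simp [quadraticFactorial]

lemma quadraticFactorial_succ (x y : ℚ) (n : ℕ) :
    quadraticFactorial x y (n + 1) = quadraticFactorial x y n * ((x + n) ^ 2 + y) := by
  simp [quadraticFactorial, Finset.prod_range_succ]

lemma quadraticFactorial_pos {x y : ℚ} (hx : 0 < x) (hy : 0 ≤ y) (n : ℕ) :
    0 < quadraticFactorial x y n :=
  Finset.prod_pos fun j _ => by positivity

/-- The summand of a very-well-poised series summed in `sum_wellPoisedTerm`. -/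
noncomputable def wellPoisedTerm (y : ℚ) (L r : ℕ) : ℚ :=
  (6 * r + 1) * shiftedFactorial (1 / 3) r * quadraticFactorial (1 / 3) y r *
    shiftedFactorial (-(L : ℚ)) r /
    (shiftedFactorial 1 r * quadraticFactorial 1 y r * shiftedFactorial 1 L *
      shiftedFactorial (4 / 3) (L + r))

/-- A telescoping certificate: the multiplier of `wellPoisedTerm y L r` is the ratio of the closed
forms in `sum_wellPoisedTerm` at `L + 1` and `L`. -/
lemma sum_range_wellPoisedTerm_sub {y : ℚ} (hy : 0 ≤ y) (L R : ℕ) :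
    ∑ r ∈ Finset.range (R + 1), (wellPoisedTerm y (L + 1) r -
        (L + 2 / 3) / ((L + 1) * ((L + 1) ^ 2 + y)) * wellPoisedTerm y L r) =
      3 * shiftedFactorial (1 / 3) (R + 1) * quadraticFactorial (1 / 3) y (R + 1) *
        shiftedFactorial (-(L : ℚ)) R /
        (shiftedFactorial 1 R * quadraticFactorial 1 y R * shiftedFactorial 1 L *
          shiftedFactorial (4 / 3) (L + R + 1) * ((L + 1) * ((L + 1) ^ 2 + y))) := by
  have hL : (0 : ℚ) < (L + 1) ^ 2 + y := by positivity
  have h1 := (shiftedFactorial_pos (x := 1) one_pos L).ne'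
  induction R with
  | zero =>
    have h4 := (shiftedFactorial_pos (x := 4 / 3) (by norm_num) L).ne'
    simp only [wellPoisedTerm, Finset.sum_range_one, shiftedFactorial_zero,
      quadraticFactorial_zero, shiftedFactorial_succ, quadraticFactorial_succ, zero_add, add_zero,
      Nat.cast_zero]
    have : (4 / 3 + L : ℚ) ≠ 0 := by positivity
    have : (1 + L : ℚ) ≠ 0 := by positivity
    have : (L + 1 : ℚ) ≠ 0 := by positivity
    field_simp
    ring
  | succ R ih =>
    rw [Finset.sum_range_succ, ih]
    have e : shiftedFactorial (-((L + 1 : ℕ) : ℚ)) (R + 1) =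
        -(L + 1 : ℚ) * shiftedFactorial (-(L : ℚ)) R := by
      rw [shiftedFactorial_succ_left]; push_cast; ring_nf
    have a1 : L + (R + 1) = L + R + 1 := by ring
    have a2 : L + 1 + (R + 1) = L + R + 1 + 1 := by ring
    simp only [wellPoisedTerm, e, a1, a2, quadraticFactorial_succ]
    simp only [shiftedFactorial_succ _ (L + R + 1), shiftedFactorial_succ _ (R + 1),
      shiftedFactorial_succ _ R, shiftedFactorial_succ _ L]
    have h4 := (shiftedFactorial_pos (x := 4 / 3) (by norm_num) (L + R + 1)).ne'
    have h5 := (shiftedFactorial_pos (x := 1) (by norm_num) R).ne'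
    have h6 := (quadraticFactorial_pos (x := 1) (by norm_num) hy R).ne'
    have h7 : (0 : ℚ) < (1 + R) ^ 2 + y := by positivity
    push_cast
    have : (4 / 3 + (L + R + 1) : ℚ) ≠ 0 := by positivity
    have : (1 + L : ℚ) ≠ 0 := by positivity
    have : (1 + R : ℚ) ≠ 0 := by positivity
    have : (L + 1 : ℚ) ≠ 0 := by positivity
    generalize shiftedFactorial (1 / 3) R = A
    generalize shiftedFactorial (4 / 3) (L + R + 1) = B at *
    generalize shiftedFactorial (-(L : ℚ)) R = C
    generalize quadraticFactorial (1 / 3) y R = D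
    field_simp
    ring

lemma sum_wellPoisedTerm {y : ℚ} (hy : 0 ≤ y) {L n : ℕ} (h : L ≤ n) :
    ∑ r ∈ Finset.range (n + 1), wellPoisedTerm y L r =
      shiftedFactorial (2 / 3) L / (shiftedFactorial 1 L * quadraticFactorial 1 y L) := by
  have hz : ∀ L : ℕ, ∀ r, L < r → wellPoisedTerm y L r = 0 := fun L r hr => by
    simp [wellPoisedTerm, shiftedFactorial_neg_of_lt hr]
  have hsub : ∀ L n : ℕ, L ≤ n → ∑ r ∈ Finset.range (n + 1), wellPoisedTerm y L r =
      ∑ r ∈ Finset.range (L + 1), wellPoisedTerm y L r := fun L n h => by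
    symm
    refine Finset.sum_subset (by simpa using h) fun r _ hr => hz L r (by simpa using hr)
  rw [hsub L n h]
  clear h
  induction L with
  | zero =>
    simp [wellPoisedTerm, shiftedFactorial_zero, quadraticFactorial_zero]
  | succ L ih =>
    have key := sum_range_wellPoisedTerm_sub hy L (L + 1)
    -- At `R = L + 1` the boundary term contains `(-L)_{L+1} = 0`, leaving a first-order recurrence
    -- in `L`.
    rw [shiftedFactorial_neg_of_lt (Nat.lt_succ_self L), mul_zero, zero_div,
      Finset.sum_sub_distrib, ← Finset.mul_sum, sub_eq_zero, hsub L (L + 1) (by omega), ih] at key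
    rw [key, shiftedFactorial_succ, shiftedFactorial_succ, quadraticFactorial_succ]
    have h1 := (shiftedFactorial_pos (x := 1) one_pos L).ne'
    have h6 := (quadraticFactorial_pos (x := 1) (by norm_num) hy L).ne'
    have h7 : (0 : ℚ) < (1 + L) ^ 2 + y := by positivity
    have h8 : (0 : ℚ) < (L + 1) ^ 2 + y := by positivity
    have : (1 + L : ℚ) ≠ 0 := by positivity
    have : (L + 1 : ℚ) ≠ 0 := by positivity
    rw [div_mul_div_comm, div_eq_div_iff (by positivity) (by positivity)]
    ring

/-! ### A balanced (Saalschütz) sum -/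

/-- The summand of the balanced series summed in `sum_balancedTerm`. -/
noncomputable def balancedTerm (r n j : ℕ) : ℚ :=
  shiftedFactorial (1 / 3) (r + j) * shiftedFactorial (-(n : ℚ)) (r + j) *
    shiftedFactorial (n + 2 / 3) (r + j) /
    (shiftedFactorial (2 / 3) (r + j) * shiftedFactorial 1 j *
      shiftedFactorial (4 / 3) (2 * r + j))

/-- The analogous certificate in `n` for fixed `r`; the multiplier is the ratio of consecutive
closed forms in `sum_balancedTerm`. -/
lemma sum_range_balancedTerm_sub (r N J : ℕ) {n : ℕ} (hn : n = r + N) :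
    ∑ j ∈ Finset.range (J + 1), (balancedTerm r (n + 1) j -
        ((n + 1) ^ 2 * (n + 2 / 3 + r) * (N + 1 / 3)) /
          ((n + 2 / 3) ^ 2 * (N + 1) * (n + 4 / 3 + r)) * balancedTerm r n j) =
      ((n + 1) * (2 * n + 5 / 3)) / ((N + 1) * (n + 2 / 3) * (n + 4 / 3 + r)) *
        (shiftedFactorial (1 / 3) (r + J + 1) * shiftedFactorial (-(n : ℚ)) (r + J) *
          shiftedFactorial (n + 2 / 3) (r + J + 1) /
          ((n + 2 / 3) * (shiftedFactorial (2 / 3) (r + J) * shiftedFactorial 1 J *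
            shiftedFactorial (4 / 3) (2 * r + J)))) := by
  have hq : (n : ℚ) = r + N := by exact_mod_cast hn
  have e : ∀ k : ℕ, shiftedFactorial (-((n + 1 : ℕ) : ℚ)) (k + 1) =
      -(n + 1 : ℚ) * shiftedFactorial (-(n : ℚ)) k := fun k => by
    rw [shiftedFactorial_succ_left]; push_cast; ring_nf
  have e' : ∀ k : ℕ, shiftedFactorial (((n + 1 : ℕ) : ℚ) + 2 / 3) k =
      shiftedFactorial (n + 2 / 3) (k + 1) / (n + 2 / 3) := fun k => by
    rw [shiftedFactorial_succ_left, mul_div_cancel_left₀ _ (by positivity)]; push_cast; ring_nf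
  have hN : (N + 1 : ℚ) ≠ 0 := by positivity
  have hn2 : (n + 2 / 3 : ℚ) ≠ 0 := by positivity
  have hn4 : (n + 4 / 3 + r : ℚ) ≠ 0 := by positivity
  induction J with
  | zero =>
    have e0 : shiftedFactorial (-((n + 1 : ℕ) : ℚ)) r =
        (n + 1) / (N + 1) * shiftedFactorial (-(n : ℚ)) r := by
      have h := e r
      rw [shiftedFactorial_succ] at h
      push_cast at h ⊢
      rw [div_mul_eq_mul_div, eq_div_iff hN]
      linear_combination -h - shiftedFactorial (-(n + 1 : ℚ)) r * hq
    simp only [balancedTerm, zero_add, Finset.sum_range_one, add_zero, e0, e', shiftedFactorial_zero,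
      shiftedFactorial_succ]
    have h2 := (shiftedFactorial_pos (x := 2 / 3) (by norm_num) r).ne'
    have h4 := (shiftedFactorial_pos (x := 4 / 3) (by norm_num) (2 * r)).ne'
    generalize shiftedFactorial (1 / 3) r = A
    generalize shiftedFactorial (-(n : ℚ)) r = B
    generalize shiftedFactorial (n + 2 / 3) r = C
    rw [hq] at hn2 hn4 ⊢
    field_simp
    ring
  | succ J ih =>
    rw [Finset.sum_range_succ, ih]
    simp only [balancedTerm, ← add_assoc, e, e']
    simp only [shiftedFactorial_succ _ (r + J + 1), shiftedFactorial_succ _ (r + J),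
      shiftedFactorial_succ _ J, shiftedFactorial_succ _ (2 * r + J)]
    have h1 := (shiftedFactorial_pos (x := 1) (by norm_num) J).ne'
    have h2 := (shiftedFactorial_pos (x := 2 / 3) (by norm_num) (r + J)).ne'
    have h4 := (shiftedFactorial_pos (x := 4 / 3) (by norm_num) (2 * r + J)).ne'
    push_cast
    have : (1 + J : ℚ) ≠ 0 := by positivity
    have : (2 / 3 + (r + J) : ℚ) ≠ 0 := by positivity
    have : (4 / 3 + (2 * r + J) : ℚ) ≠ 0 := by positivity
    generalize shiftedFactorial (1 / 3) (r + J) = A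
    generalize shiftedFactorial (-(n : ℚ)) (r + J) = B
    generalize shiftedFactorial (n + 2 / 3) (r + J) = C
    rw [hq] at hn2 hn4 ⊢
    field_simp
    ring

lemma shiftedFactorial_add (x : ℚ) (m n : ℕ) :
    shiftedFactorial x (m + n) = shiftedFactorial x m * shiftedFactorial (x + m) n := by
  simp only [shiftedFactorial_eq_prod, Finset.prod_range_add]
  push_cast
  simp only [add_assoc]

lemma shiftedFactorial_reflect (x : ℚ) (n : ℕ) :
    shiftedFactorial (1 - x - n) n = (-1) ^ n * shiftedFactorial x n := by
  rw [shiftedFactorial_eq_prod, shiftedFactorial_eq_prod, ← Finset.prod_range_reflect]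
  have hc : (-1 : ℚ) ^ n = ∏ _j ∈ Finset.range n, (-1 : ℚ) := by simp
  rw [hc, ← Finset.prod_mul_distrib]
  refine Finset.prod_congr rfl fun j hj => ?_
  have hj := Finset.mem_range.1 hj
  have : ((n - 1 - j : ℕ) : ℚ) = n - 1 - j := by
    rw [Nat.cast_sub (by omega), Nat.cast_sub (by omega)]; simp
  rw [this]; ring

/-- A vanishing factor would give `2 + 3j = 3n`, impossible mod 3. -/
lemma shiftedFactorial_two_thirds_sub_ne_zero (n k : ℕ) :
    shiftedFactorial (2 / 3 - (n : ℚ)) k ≠ 0 := by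
  rw [shiftedFactorial_eq_prod, Finset.prod_ne_zero_iff]
  intro j _ h
  have : ((2 + 3 * j : ℕ) : ℚ) = (3 * n : ℕ) := by push_cast; linarith
  have := Nat.cast_injective this
  omega

/-- Induction on `N = n - r`: the case `n = r` has the single term `j = 0`, and the certificate
supplies the recurrence because its boundary term vanishes at `J = N + 1`. -/
lemma sum_balancedTerm (r N : ℕ) {n : ℕ} (hn : n = r + N) :
    ∑ j ∈ Finset.range (N + 1), balancedTerm r n j =
      (-1) ^ r * shiftedFactorial (1 / 3) r / shiftedFactorial 1 r *
        (shiftedFactorial (-(n : ℚ)) r * shiftedFactorial (n + 2 / 3) r) /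
        (shiftedFactorial (2 / 3 - (n : ℚ)) r * shiftedFactorial (4 / 3 + n) r) *
        (shiftedFactorial 1 n / ((3 * n + 1) * shiftedFactorial (2 / 3) n)) := by
  induction N generalizing n with
  | zero =>
    rw [add_zero] at hn
    subst n
    have r1 := shiftedFactorial_reflect (1 / 3) r
    rw [show (1 - 1 / 3 - r : ℚ) = 2 / 3 - r by ring] at r1
    have a1 := shiftedFactorial_add (4 / 3) r r
    have a2 : shiftedFactorial (4 / 3) r = (3 * r + 1) * shiftedFactorial (1 / 3) r := by
      have := shiftedFactorial_succ (1 / 3) r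
      rw [shiftedFactorial_succ_left] at this
      norm_num at this
      linarith
    have h1 := (shiftedFactorial_pos (x := 1) (by norm_num) r).ne'
    have h2 := (shiftedFactorial_pos (x := 2 / 3) (by norm_num) r).ne'
    have h3 := (shiftedFactorial_pos (x := 1 / 3) (by norm_num) r).ne'
    have h4 := (shiftedFactorial_pos (x := 4 / 3 + r) (by positivity) r).ne'
    have h5 : (3 * r + 1 : ℚ) ≠ 0 := by positivity
    simp only [balancedTerm, zero_add, Finset.sum_range_one, add_zero, shiftedFactorial_zero,
      two_mul, a1, a2, r1]
    field_simp
  | succ N ih =>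
    obtain ⟨m, rfl⟩ : ∃ m, n = m + 1 := ⟨r + N, hn⟩
    have hm : m = r + N := by omega
    have hq : (m : ℚ) = r + N := by exact_mod_cast hm
    have key := sum_range_balancedTerm_sub r N (N + 1) hm
    rw [show r + (N + 1) = m + 1 by omega, shiftedFactorial_neg_of_lt (Nat.lt_succ_self m),
      mul_zero, zero_mul, zero_div, mul_zero, Finset.sum_sub_distrib, ← Finset.mul_sum, sub_eq_zero,
      Finset.sum_range_succ (fun j => balancedTerm r m j), ih hm,
      show balancedTerm r m (N + 1) = 0 by
        simp [balancedTerm, shiftedFactorial_neg_of_lt (show m < r + (N + 1) by omega)],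
      add_zero] at key
    rw [key]
    have e1 : shiftedFactorial (-(m + 1 : ℚ)) r * (N + 1) =
        (m + 1) * shiftedFactorial (-(m : ℚ)) r := by
      have h := shiftedFactorial_succ (-(m + 1 : ℚ)) r
      rw [shiftedFactorial_succ_left, show -(m + 1 : ℚ) + 1 = -m by ring, hq] at h
      rw [hq]; linear_combination h
    have e2 : shiftedFactorial (m + 1 + 2 / 3) r * (m + 2 / 3) =
        (m + 2 / 3 + r) * shiftedFactorial (m + 2 / 3) r := by
      have h := shiftedFactorial_succ (m + 2 / 3) r
      rw [shiftedFactorial_succ_left, show (m + 2 / 3 + 1 : ℚ) = m + 1 + 2 / 3 by ring] at h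
      linear_combination h
    have e3 : shiftedFactorial (2 / 3 - (m + 1 : ℚ)) r * (N + 1 / 3) =
        (m + 1 / 3) * shiftedFactorial (2 / 3 - (m : ℚ)) r := by
      have h := shiftedFactorial_succ (2 / 3 - (m + 1 : ℚ)) r
      rw [shiftedFactorial_succ_left, show (2 / 3 - (m + 1 : ℚ)) + 1 = 2 / 3 - m by ring, hq] at h
      rw [hq]; linear_combination h
    have e4 : shiftedFactorial (4 / 3 + (m + 1 : ℚ)) r * (m + 4 / 3) =
        (m + 4 / 3 + r) * shiftedFactorial (4 / 3 + (m : ℚ)) r := by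
      have h := shiftedFactorial_succ (4 / 3 + m) r
      rw [shiftedFactorial_succ_left, show (4 / 3 + m + 1 : ℚ) = 4 / 3 + (m + 1) by ring] at h
      linear_combination h
    have hN : (N + 1 : ℚ) ≠ 0 := by positivity
    have hN3 : (N + 1 / 3 : ℚ) ≠ 0 := by positivity
    have hm2 : (m + 2 / 3 : ℚ) ≠ 0 := by positivity
    have hm4 : (m + 4 / 3 : ℚ) ≠ 0 := by positivity
    have hm1 : (m + 1 / 3 : ℚ) ≠ 0 := by positivity
    have hm4r : (m + 4 / 3 + r : ℚ) ≠ 0 := by positivity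
    rw [← eq_div_iff (by assumption)] at e1 e2 e3 e4
    push_cast
    rw [e1, e2, e3, e4, shiftedFactorial_succ, shiftedFactorial_succ]
    have h1 := (shiftedFactorial_pos (x := 1) (by norm_num) r).ne'
    have h2 := (shiftedFactorial_pos (x := 2 / 3) (by norm_num) m).ne'
    have h3 := shiftedFactorial_two_thirds_sub_ne_zero m r
    have h4 := (shiftedFactorial_pos (x := 4 / 3 + m) (by positivity) r).ne'
    have : (3 * m + 1 : ℚ) ≠ 0 := by positivity
    have : (3 * (m + 1) + 1 : ℚ) ≠ 0 := by positivity
    have : (2 / 3 + m : ℚ) ≠ 0 := by positivity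
    generalize shiftedFactorial (1 / 3) r = A
    generalize shiftedFactorial (-(m : ℚ)) r = B
    generalize shiftedFactorial (m + 2 / 3) r = C
    generalize shiftedFactorial 1 m = D
    generalize shiftedFactorial (2 / 3) m = E at *
    generalize shiftedFactorial 1 r = F at *
    generalize shiftedFactorial (2 / 3 - m) r = G at *
    generalize shiftedFactorial (4 / 3 + m) r = H at *
    field_simp
    ring

/-! ### The transformation formula -/

/-- With `L = r + j`, one has `(-L)_r / (1)_L = (-1)^r / (1)_j`. This separates a factor depending
only on `r` and leaves a balanced summand in `j`. -/
lemma mul_wellPoisedTerm (y : ℚ) (n r j : ℕ) :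
    shiftedFactorial (1 / 3) (r + j) *
        (shiftedFactorial (-(n : ℚ)) (r + j) * shiftedFactorial (n + 2 / 3) (r + j)) /
        shiftedFactorial (2 / 3) (r + j) * wellPoisedTerm y (r + j) r =
      (-1) ^ r * ((6 * r + 1) * shiftedFactorial (1 / 3) r * quadraticFactorial (1 / 3) y r /
        (shiftedFactorial 1 r * quadraticFactorial 1 y r)) * balancedTerm r n j := by
  have h1 := shiftedFactorial_reflect (1 + j) r
  rw [show (1 - (1 + j) - r : ℚ) = -((r + j : ℕ) : ℚ) by push_cast; ring] at h1
  have h2 : shiftedFactorial 1 (r + j) = shiftedFactorial 1 j * shiftedFactorial (1 + j) r := by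
    rw [add_comm r j, shiftedFactorial_add]
  have h3 := (shiftedFactorial_pos (x := 1 + j) (by positivity) r).ne'
  rw [wellPoisedTerm, balancedTerm, h1, h2, show r + j + r = 2 * r + j by ring]
  have h4 : shiftedFactorial (1 + j) r / shiftedFactorial (1 + j) r = 1 := div_self h3
  field_simp

/-- A transformation of a terminating very-well-poised `₇F₆` series into a `₃F₂` series. -/
lemma sum_wellPoised_eq {y : ℚ} (hy : 0 ≤ y) (n : ℕ) :
    ∑ r ∈ Finset.range (n + 1), (6 * (r : ℚ) + 1) *
        (shiftedFactorial (1 / 3) r / shiftedFactorial 1 r) ^ 2 *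
        (shiftedFactorial (-(n : ℚ)) r * shiftedFactorial (n + 2 / 3) r /
          (shiftedFactorial (2 / 3 - (n : ℚ)) r * shiftedFactorial (4 / 3 + n) r)) *
        (quadraticFactorial (1 / 3) y r / quadraticFactorial 1 y r) =
      (3 * n + 1) * (shiftedFactorial (2 / 3) n / shiftedFactorial 1 n) *
        ∑ L ∈ Finset.range (n + 1), shiftedFactorial (1 / 3) L / shiftedFactorial 1 L *
          (shiftedFactorial (-(n : ℚ)) L * shiftedFactorial (n + 2 / 3) L /
            quadraticFactorial 1 y L) := by
  have key : ∀ L ∈ Finset.range (n + 1),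
      shiftedFactorial (1 / 3) L / shiftedFactorial 1 L *
          (shiftedFactorial (-(n : ℚ)) L * shiftedFactorial (n + 2 / 3) L /
            quadraticFactorial 1 y L) =
      ∑ r ∈ Finset.range (n + 1), shiftedFactorial (1 / 3) L *
        (shiftedFactorial (-(n : ℚ)) L * shiftedFactorial (n + 2 / 3) L) /
        shiftedFactorial (2 / 3) L * wellPoisedTerm y L r := fun L hL => by
    rw [← Finset.mul_sum, sum_wellPoisedTerm hy (Nat.lt_succ_iff.1 (Finset.mem_range.1 hL))]
    have h2 := (shiftedFactorial_pos (x := 2 / 3) (by norm_num) L).ne'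
    field_simp
  rw [Finset.sum_congr rfl key, Finset.sum_comm, Finset.mul_sum]
  refine Finset.sum_congr rfl fun r hr => ?_
  obtain ⟨N, rfl⟩ := Nat.exists_eq_add_of_le (Nat.lt_succ_iff.1 (Finset.mem_range.1 hr))
  -- Terms with `L < r` vanish, so the inner sum runs over `L = r + j` with `j ≤ N`.
  rw [add_assoc r N 1, Finset.sum_range_add, Finset.sum_eq_zero, zero_add,
    Finset.sum_congr rfl fun j _ => mul_wellPoisedTerm y (r + N) r j, ← Finset.mul_sum,
    sum_balancedTerm r N rfl]
  · have h1 := (shiftedFactorial_pos (x := 1) (by norm_num) (r + N)).ne'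
    have h2 := (shiftedFactorial_pos (x := 2 / 3) (by norm_num) (r + N)).ne'
    have h3 : (3 * ((r + N : ℕ) : ℚ) + 1) ≠ 0 := by positivity
    -- One sign comes from `mul_wellPoisedTerm`, the other from `sum_balancedTerm`.
    have h4 : ((-1 : ℚ) ^ r) ^ 2 = 1 := by rw [← pow_mul, mul_comm, pow_mul]; simp
    generalize (-1 : ℚ) ^ r = s at *
    field_simp
    rw [h4, mul_one]
  · intro L hL
    simp [wellPoisedTerm, shiftedFactorial_neg_of_lt (Finset.mem_range.1 hL)]

/-! ### Congruences over the `p`-integral rationals -/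

/-- The rational numbers whose reduced denominator is prime to `p`. -/
def pIntegers (p : ℕ) (hp : p.Prime) : Subring ℚ where
  carrier := {q | ¬ p ∣ q.den}
  mul_mem' {a b} ha hb h := by
    rcases hp.dvd_mul.1 (h.trans (Rat.mul_den_dvd a b)) with h | h
    exacts [ha h, hb h]
  one_mem' := by simpa using hp.one_lt.ne'
  add_mem' {a b} ha hb h := by
    rcases hp.dvd_mul.1 (h.trans (Rat.add_den_dvd a b)) with h | h
    exacts [ha h, hb h]
  zero_mem' := by simpa using hp.one_lt.ne'
  neg_mem' {a} ha := by simpa using ha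

section

variable {p : ℕ} {hp : p.Prime}

lemma inv_intCast_mem_pIntegers {k : ℤ} (hk : ¬ (p : ℤ) ∣ k) : (k : ℚ)⁻¹ ∈ pIntegers p hp := by
  intro h
  have := Rat.den_dvd 1 k
  rw [← Rat.intCast_div_eq_divInt, Int.cast_one, one_div] at this
  exact hk ((Int.natCast_dvd_natCast.2 h).trans this)

lemma inv_natCast_mem_pIntegers {k : ℕ} (hk : ¬ p ∣ k) : (k : ℚ)⁻¹ ∈ pIntegers p hp := by
  have := inv_intCast_mem_pIntegers (hp := hp) (k := k) (by rwa [Int.natCast_dvd_natCast])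
  simpa using this

lemma ratModEqPow_of_sub_eq {e : ℕ} {a b c : ℚ} (hc : c ∈ pIntegers p hp)
    (h : a - b = (p : ℚ) ^ e * c) : RatModEqPow p e a b := ⟨c, hc, h⟩

lemma exists_mem_pIntegers {e : ℕ} {a b : ℚ} (hp : p.Prime) (h : RatModEqPow p e a b) :
    ∃ c ∈ pIntegers p hp, a - b = (p : ℚ) ^ e * c := h

lemma RatModEqPow.mem {e : ℕ} {a b : ℚ} (h : RatModEqPow p e a b) (hb : b ∈ pIntegers p hp) :
    a ∈ pIntegers p hp := by
  obtain ⟨c, hc, h⟩ := h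
  rw [sub_eq_iff_eq_add.1 h]
  exact add_mem (mul_mem (pow_mem (natCast_mem _ p) e) hc) hb

lemma RatModEqPow.refl' (hp : p.Prime) (e : ℕ) (a : ℚ) : RatModEqPow p e a a :=
  ⟨0, zero_mem (pIntegers p hp), by simp⟩

lemma RatModEqPow.symm' (hp : p.Prime) {e : ℕ} {a b : ℚ} (h : RatModEqPow p e a b) :
    RatModEqPow p e b a := by
  obtain ⟨x, hx, h⟩ := exists_mem_pIntegers hp h
  exact ratModEqPow_of_sub_eq (neg_mem hx) (by linear_combination -h)

lemma RatModEqPow.trans' (hp : p.Prime) {e : ℕ} {a b c : ℚ} (h : RatModEqPow p e a b)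
    (h' : RatModEqPow p e b c) : RatModEqPow p e a c := by
  obtain ⟨x, hx, h⟩ := exists_mem_pIntegers hp h
  obtain ⟨y, hy, h'⟩ := exists_mem_pIntegers hp h'
  exact ratModEqPow_of_sub_eq (add_mem hx hy) (by linear_combination h + h')

lemma RatModEqPow.mul' {e : ℕ} {a b c d : ℚ} (h : RatModEqPow p e a b)
    (h' : RatModEqPow p e c d) (hb : b ∈ pIntegers p hp) (hd : d ∈ pIntegers p hp) :
    RatModEqPow p e (a * c) (b * d) := by
  have hc := h'.mem hd
  obtain ⟨x, hx, h⟩ := exists_mem_pIntegers hp h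
  obtain ⟨y, hy, h'⟩ := exists_mem_pIntegers hp h'
  exact ratModEqPow_of_sub_eq (add_mem (mul_mem hx hc) (mul_mem hb hy))
    (by linear_combination c * h + b * h')

lemma RatModEqPow.sum' (hp : p.Prime) {ι : Type*} {e : ℕ} {s : Finset ι} {f g : ι → ℚ}
    (h : ∀ i ∈ s, RatModEqPow p e (f i) (g i)) :
    RatModEqPow p e (∑ i ∈ s, f i) (∑ i ∈ s, g i) := by
  classical
  choose! c hc h using fun i hi => exists_mem_pIntegers hp (h i hi)
  refine ratModEqPow_of_sub_eq (sum_mem hc) ?_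
  rw [← Finset.sum_sub_distrib, Finset.mul_sum]
  exact Finset.sum_congr rfl h

lemma RatModEqPow.prod' {ι : Type*} {e : ℕ} {s : Finset ι} {f g : ι → ℚ}
    (h : ∀ i ∈ s, RatModEqPow p e (f i) (g i)) (hg : ∀ i ∈ s, g i ∈ pIntegers p hp) :
    RatModEqPow p e (∏ i ∈ s, f i) (∏ i ∈ s, g i) := by
  classical
  induction s using Finset.induction_on with
  | empty => simpa using RatModEqPow.refl' hp e 1
  | insert i s hi ih =>
    rw [Finset.prod_insert hi, Finset.prod_insert hi]
    refine (h i (by simp)).mul' (ih (fun j hj => h j (by simp [hj])) fun j hj => hg j (by simp [hj]))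
      (hg i (by simp)) (prod_mem fun j hj => hg j (by simp [hj]))

end

/-! ### Factorial quotients modulo powers of `p` -/

lemma shiftedFactorial_div_eq_prod (x : ℚ) (k : ℕ) :
    shiftedFactorial x k / shiftedFactorial 1 k = ∏ j ∈ Finset.range k, ((x + j) / (1 + j)) := by
  rw [shiftedFactorial_eq_prod, shiftedFactorial_eq_prod, Finset.prod_div_distrib]

section

variable {p n : ℕ} {hp : p.Prime}

lemma inv_one_add_mem_pIntegers {j : ℕ} (hj : j + 1 < p) :
    (1 + j : ℚ)⁻¹ ∈ pIntegers p hp := by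
  have := inv_natCast_mem_pIntegers (hp := hp) (Nat.not_dvd_of_pos_of_lt (Nat.succ_pos j) hj)
  rwa [Nat.cast_succ, add_comm] at this

lemma not_dvd_three (hp : p.Prime) (hn : p = 3 * n + 1) : ¬ p ∣ 3 := fun h => by
  have := (Nat.prime_dvd_prime_iff_eq hp Nat.prime_three).1 h
  omega

lemma div_three_mem_pIntegers (hn : p = 3 * n + 1) {a : ℚ} (ha : a ∈ pIntegers p hp) :
    a / 3 ∈ pIntegers p hp := by
  have := inv_natCast_mem_pIntegers (hp := hp) (not_dvd_three hp hn)
  rw [div_eq_mul_inv]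
  exact mul_mem ha (by simpa using this)

lemma shiftedFactorial_div_mem_pIntegers (hn : p = 3 * n + 1) (a : ℕ) {k : ℕ} (hk : k < p) :
    shiftedFactorial (a / 3) k / shiftedFactorial 1 k ∈ pIntegers p hp := by
  rw [shiftedFactorial_div_eq_prod]
  refine prod_mem fun j hj => mul_mem (add_mem (div_three_mem_pIntegers hn (natCast_mem _ a))
    (natCast_mem _ j)) (inv_one_add_mem_pIntegers ?_)
  have := Finset.mem_range.1 hj
  omega

lemma third_div_mem_pIntegers (hn : p = 3 * n + 1) {k : ℕ} (hk : k < p) :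
    shiftedFactorial (1 / 3) k / shiftedFactorial 1 k ∈ pIntegers p hp := by
  simpa using shiftedFactorial_div_mem_pIntegers (hp := hp) hn 1 hk

/-- The factor with `j = n` is `(p/3) / (1 + n)`, and all the others are `p`-integral. -/
lemma ratModEqPow_third_div_zero (hp : p.Prime) (hn : p = 3 * n + 1) {k : ℕ} (hnk : n < k)
    (hk : k < p) : RatModEqPow p 1 (shiftedFactorial (1 / 3) k / shiftedFactorial 1 k) 0 := by
  rw [shiftedFactorial_div_eq_prod, ← Finset.mul_prod_erase _ _ (Finset.mem_range.2 hnk)]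
  have hq : (p : ℚ) = 3 * n + 1 := by exact_mod_cast hn
  have h3 : (1 / 3 : ℚ) ∈ pIntegers p hp := div_three_mem_pIntegers hn (one_mem _)
  refine ratModEqPow_of_sub_eq (hp := hp)
    (c := 1 / 3 * (1 + n : ℚ)⁻¹ * ∏ j ∈ (Finset.range k).erase n, ((1 / 3 + j : ℚ) / (1 + j)))
    (mul_mem (mul_mem h3 (inv_one_add_mem_pIntegers (by omega))) (prod_mem fun j hj =>
      mul_mem (add_mem h3 (natCast_mem _ j)) (inv_one_add_mem_pIntegers ?_))) ?_
  · have := Finset.mem_range.1 (Finset.mem_of_mem_erase hj)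
    omega
  · rw [hq, div_eq_mul_inv]; ring

/-- Each factor changes by a multiple of `p ^ 4`, since the denominators `(1 + j) ^ 4 - (p/3) ^ 4`
are `p`-adic units for `j < n`. -/
lemma ratModEqPow_quartic_prod (hp : p.Prime) (hn : p = 3 * n + 1) {k : ℕ} (hk : k ≤ n) :
    RatModEqPow p 4 (∏ j ∈ Finset.range k,
        (((1 / 3 + j : ℚ) ^ 4 - (p / 3) ^ 4) / ((1 + j) ^ 4 - (p / 3) ^ 4)))
      ((shiftedFactorial (1 / 3) k / shiftedFactorial 1 k) ^ 4) := by
  have h3 : (1 / 3 : ℚ) ∈ pIntegers p hp := div_three_mem_pIntegers hn (one_mem _)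
  rw [shiftedFactorial_div_eq_prod, ← Finset.prod_pow]
  refine RatModEqPow.prod' (hp := hp) (fun j hj => ?_) fun j hj => ?_ <;>
    have hj := Finset.mem_range.1 hj <;>
    have hi := inv_one_add_mem_pIntegers (hp := hp) (show j + 1 < p by omega)
  · have hd : ¬ (p : ℤ) ∣ (3 * (1 + j)) ^ 4 - (p : ℤ) ^ 4 := fun h => by
      have h' := (dvd_sub_left (dvd_pow_self (p : ℤ) (by norm_num))).1 h
      have h'' := hp.dvd_of_dvd_pow (n := 4) (m := 3 * (1 + j)) (by exact_mod_cast h')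
      rcases hp.dvd_mul.1 h'' with h | h
      · exact not_dvd_three hp hn h
      · exact Nat.not_dvd_of_pos_of_lt (by omega) (by omega) h
    have h0 : (((3 * (1 + j)) ^ 4 - (p : ℤ) ^ 4 : ℤ) : ℚ) ≠ 0 :=
      Int.cast_ne_zero.2 fun h => hd (h ▸ dvd_zero _)
    have hm := inv_intCast_mem_pIntegers (hp := hp) hd
    refine ratModEqPow_of_sub_eq (hp := hp) (mul_mem
      (mul_mem (sub_mem (pow_mem (add_mem h3 (natCast_mem _ j)) 4)
        (pow_mem (add_mem (one_mem _) (natCast_mem _ j)) 4)) (pow_mem hi 4)) hm) ?_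
    have hj0 : (1 + j : ℚ) ≠ 0 := by positivity
    have e : (1 + j : ℚ) ^ 4 - (p / 3) ^ 4 = (((3 * (1 + j)) ^ 4 - (p : ℤ) ^ 4 : ℤ) : ℚ) / 81 := by
      push_cast; ring
    rw [e]
    have e' : (p : ℚ) ^ 4 = (3 * (1 + j)) ^ 4 - (((3 * (1 + j)) ^ 4 - (p : ℤ) ^ 4 : ℤ) : ℚ) := by
      push_cast; ring
    rw [show (p / 3 : ℚ) ^ 4 = (p : ℚ) ^ 4 / 81 by ring, e']
    generalize (((3 * (1 + j)) ^ 4 - (p : ℤ) ^ 4 : ℤ) : ℚ) = D at *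
    field_simp
    ring
  · exact pow_mem (mul_mem (add_mem h3 (natCast_mem _ j)) hi) 4

lemma sum_inv_sq_mem_pIntegers (hp : p.Prime) (hn : p = 3 * n + 1) {k : ℕ} (hk : k ≤ n) :
    ∑ t ∈ Finset.Icc 1 k, (1 / (3 * (t : ℚ) - 2) ^ 2 + 1 / (3 * (t : ℚ)) ^ 2) ∈
      pIntegers p hp := by
  refine sum_mem fun t ht => ?_
  obtain ⟨h1, h2⟩ := Finset.mem_Icc.1 ht
  have hm1 := inv_natCast_mem_pIntegers (hp := hp) (k := 3 * t - 2)
    (Nat.not_dvd_of_pos_of_lt (by omega) (by omega))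
  have hm2 := inv_natCast_mem_pIntegers (hp := hp) (k := 3 * t)
    (Nat.not_dvd_of_pos_of_lt (by omega) (by omega))
  rw [Nat.cast_sub (by omega)] at hm1
  push_cast at hm1 hm2
  simp only [one_div, ← inv_pow]
  exact add_mem (pow_mem hm1 2) (pow_mem hm2 2)

/-- To first order in `p ^ 2`, the factor at `j = t - 1` is its value without the shifts times `1 -
p^2/(3t-2)^2 - p^2/(3t)^2`; products of corrections are `O(p ^ 4)`. -/
lemma ratModEqPow_quadratic_prod (hp : p.Prime) (hn : p = 3 * n + 1) {k : ℕ} (hk : k ≤ n) :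
    RatModEqPow p 4 (∏ j ∈ Finset.range k,
        (((1 / 3 + j : ℚ) ^ 2 - (p / 3) ^ 2) / ((1 + j) ^ 2 + (p / 3) ^ 2)))
      ((shiftedFactorial (1 / 3) k / shiftedFactorial 1 k) ^ 2 * (1 - (p : ℚ) ^ 2 *
        ∑ t ∈ Finset.Icc 1 k, (1 / (3 * (t : ℚ) - 2) ^ 2 + 1 / (3 * (t : ℚ)) ^ 2))) := by
  have h3 : (1 / 3 : ℚ) ∈ pIntegers p hp := div_three_mem_pIntegers hn (one_mem _)
  induction k with
  | zero => simpa [shiftedFactorial_zero] using RatModEqPow.refl' hp 4 1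
  | succ k ih =>
    have hu := third_div_mem_pIntegers (hp := hp) hn (show k < p by omega)
    have hs := sum_inv_sq_mem_pIntegers hp hn (show k ≤ n by omega)
    have hi := inv_one_add_mem_pIntegers (hp := hp) (show k + 1 < p by omega)
    have hw := inv_natCast_mem_pIntegers (hp := hp) (k := 3 * k + 1)
      (Nat.not_dvd_of_pos_of_lt (by omega) (by omega))
    have hd : ¬ p ∣ (3 * (1 + k)) ^ 2 + p ^ 2 := fun h => by
      have h' := hp.dvd_of_dvd_pow ((Nat.dvd_add_left (dvd_pow_self p (by norm_num))).1 h)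
      exact Nat.not_dvd_of_pos_of_lt (by omega) (by omega) h'
    have hm := inv_natCast_mem_pIntegers (hp := hp) hd
    have hr : (1 / 3 + k : ℚ) / (1 + k) ∈ pIntegers p hp :=
      mul_mem (add_mem h3 (natCast_mem _ k)) hi
    have hpq : (p : ℚ) ∈ pIntegers p hp := natCast_mem _ p
    have hkq : (k : ℚ) ∈ pIntegers p hp := natCast_mem _ k
    have ht : (1 / (3 * ((k + 1 : ℕ) : ℚ) - 2) ^ 2 + 1 / (3 * ((k + 1 : ℕ) : ℚ)) ^ 2) ∈
        pIntegers p hp := by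
      have e : (1 / (3 * ((k + 1 : ℕ) : ℚ) - 2) ^ 2 + 1 / (3 * ((k + 1 : ℕ) : ℚ)) ^ 2) =
          (((3 * k + 1 : ℕ) : ℚ)⁻¹) ^ 2 + (1 / 3 * (1 + k : ℚ)⁻¹) ^ 2 := by
        push_cast
        rw [show (3 * (k + 1 : ℚ) - 2) = 3 * k + 1 by ring]
        have : (1 + k : ℚ) ≠ 0 := by positivity
        have : (k + 1 : ℚ) ≠ 0 := by positivity
        field_simp
        ring
      rw [e]
      exact add_mem (pow_mem hw 2) (pow_mem (mul_mem h3 hi) 2)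
    have step : RatModEqPow p 4
        (((1 / 3 + k : ℚ) ^ 2 - (p / 3) ^ 2) / ((1 + k) ^ 2 + (p / 3) ^ 2))
        (((1 / 3 + k) / (1 + k)) ^ 2 * (1 - (p : ℚ) ^ 2 *
          (1 / (3 * ((k + 1 : ℕ) : ℚ) - 2) ^ 2 + 1 / (3 * ((k + 1 : ℕ) : ℚ)) ^ 2))) := by
      refine ratModEqPow_of_sub_eq (hp := hp)
        (mul_mem (mul_mem (mul_mem (pow_mem h3 2) (add_mem
          (pow_mem (add_mem h3 hkq) 2) (pow_mem (add_mem (one_mem _) hkq) 2))) (pow_mem hi 4)) hm) ?_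
      push_cast
      rw [show (3 * (k + 1 : ℚ) - 2) = 3 * k + 1 by ring]
      have : (1 + k : ℚ) ≠ 0 := by positivity
      have : (k + 1 : ℚ) ≠ 0 := by positivity
      have : (3 * k + 1 : ℚ) ≠ 0 := by positivity
      have : ((3 * (1 + k)) ^ 2 + p ^ 2 : ℚ) ≠ 0 := by positivity
      have : ((1 + k) ^ 2 + (p / 3) ^ 2 : ℚ) ≠ 0 := by positivity
      field_simp
      ring
    have key := (ih (by omega)).mul' (hp := hp) step
      (mul_mem (pow_mem hu 2) (sub_mem (one_mem _) (mul_mem (pow_mem hpq 2) hs)))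
      (mul_mem (pow_mem hr 2) (sub_mem (one_mem _) (mul_mem (pow_mem hpq 2) ht)))
    rw [Finset.prod_range_succ, Finset.sum_Icc_succ_top (by omega)]
    -- The discarded cross term is `p ^ 4` times the old correction sum times the new correction.
    refine key.trans' hp (ratModEqPow_of_sub_eq (hp := hp)
      (mul_mem (mul_mem (pow_mem hu 2) (pow_mem hr 2)) (mul_mem hs ht)) ?_)
    rw [shiftedFactorial_succ, shiftedFactorial_succ, mul_div_mul_comm]
    ring

end

/-! ### The single series modulo `p ^ 4` -/

lemma shiftedFactorial_mul_eq_prod (n k : ℕ) :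
    shiftedFactorial (-(n : ℚ)) k * shiftedFactorial (n + 2 / 3) k =
      ∏ j ∈ Finset.range k, ((1 / 3 + j : ℚ) ^ 2 - (n + 1 / 3) ^ 2) := by
  rw [shiftedFactorial_eq_prod, shiftedFactorial_eq_prod, ← Finset.prod_mul_distrib]
  exact Finset.prod_congr rfl fun j _ => by ring

lemma shiftedFactorial_mul_eq_prod' (n k : ℕ) :
    shiftedFactorial (2 / 3 - (n : ℚ)) k * shiftedFactorial (4 / 3 + n) k =
      ∏ j ∈ Finset.range k, ((1 + j : ℚ) ^ 2 - (n + 1 / 3) ^ 2) := by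
  rw [shiftedFactorial_eq_prod, shiftedFactorial_eq_prod, ← Finset.prod_mul_distrib]
  exact Finset.prod_congr rfl fun j _ => by ring

section

variable {p n : ℕ}

/-- This is `sum_wellPoised_eq` at `y = (p/3) ^ 2`: since `n + 1/3 = p/3`, the factors `a ^ 2 - y`
and `a ^ 2 + y` combine into `a ^ 4 - (p/3) ^ 4`. -/
lemma sum_quartic_eq (hn : p = 3 * n + 1) :
    ∑ k ∈ Finset.range (n + 1), (6 * (k : ℚ) + 1) *
        (shiftedFactorial (1 / 3) k / shiftedFactorial 1 k) ^ 2 *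
        ∏ j ∈ Finset.range k,
          (((1 / 3 + j : ℚ) ^ 4 - (p / 3) ^ 4) / ((1 + j) ^ 4 - (p / 3) ^ 4)) =
      p * (shiftedFactorial (2 / 3) n / shiftedFactorial 1 n) *
        ∑ k ∈ Finset.range (n + 1), shiftedFactorial (1 / 3) k / shiftedFactorial 1 k *
          ∏ j ∈ Finset.range k,
            (((1 / 3 + j : ℚ) ^ 2 - (p / 3) ^ 2) / ((1 + j) ^ 2 + (p / 3) ^ 2)) := by
  have hq : (p : ℚ) = 3 * n + 1 := by exact_mod_cast hn
  have hx : (n + 1 / 3 : ℚ) = p / 3 := by rw [hq]; ring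
  have key := sum_wellPoised_eq (sq_nonneg ((p : ℚ) / 3)) n
  rw [← hq] at key
  calc _ = _ := Finset.sum_congr rfl fun k _ => ?_
    _ = _ := key
    _ = _ := congrArg _ (Finset.sum_congr rfl fun k _ => ?_)
  · rw [shiftedFactorial_mul_eq_prod, shiftedFactorial_mul_eq_prod', mul_assoc _ (_ / _) (_ / _),
      div_mul_div_comm, quadraticFactorial, quadraticFactorial, ← Finset.prod_mul_distrib,
      ← Finset.prod_mul_distrib, ← Finset.prod_div_distrib, hx]
    congr 1
    exact Finset.prod_congr rfl fun j _ => by ring_nf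
  · rw [shiftedFactorial_mul_eq_prod, quadraticFactorial, ← Finset.prod_div_distrib, hx]

/-- The truncated single series modulo `p ^ 4`. -/
lemma ratModEqPow_sum_third_pow_six (hp : p.Prime) (hn : p = 3 * n + 1) :
    RatModEqPow p 4
      (∑ k ∈ Finset.range (n + 1), (6 * (k : ℚ) + 1) *
        (shiftedFactorial (1 / 3) k / shiftedFactorial 1 k) ^ 6)
      (p * (shiftedFactorial (2 / 3) n / shiftedFactorial 1 n) *
        ∑ k ∈ Finset.range (n + 1), (shiftedFactorial (1 / 3) k / shiftedFactorial 1 k) ^ 3 *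
          (1 - (p : ℚ) ^ 2 *
            ∑ t ∈ Finset.Icc 1 k, (1 / (3 * (t : ℚ) - 2) ^ 2 + 1 / (3 * (t : ℚ)) ^ 2))) := by
  have hu : ∀ k ∈ Finset.range (n + 1),
      shiftedFactorial (1 / 3) k / shiftedFactorial 1 k ∈ pIntegers p hp := fun k hk =>
    third_div_mem_pIntegers hn (by have := Finset.mem_range.1 hk; omega)
  have hle : ∀ k ∈ Finset.range (n + 1), k ≤ n := fun k hk =>
    Nat.lt_succ_iff.1 (Finset.mem_range.1 hk)
  have hpm : (p : ℚ) ∈ pIntegers p hp := natCast_mem _ p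
  have hR : shiftedFactorial (2 / 3) n / shiftedFactorial 1 n ∈ pIntegers p hp := by
    simpa using shiftedFactorial_div_mem_pIntegers (hp := hp) hn 2 (show n < p by omega)
  have hmem : ∀ k ∈ Finset.range (n + 1),
      (shiftedFactorial (1 / 3) k / shiftedFactorial 1 k) ^ 2 * (1 - (p : ℚ) ^ 2 *
            ∑ t ∈ Finset.Icc 1 k, (1 / (3 * (t : ℚ) - 2) ^ 2 + 1 / (3 * (t : ℚ)) ^ 2)) ∈
        pIntegers p hp := fun k hk =>
    mul_mem (pow_mem (hu k hk) 2) (sub_mem (one_mem _) (mul_mem (pow_mem hpm 2)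
      (sum_inv_sq_mem_pIntegers hp hn (hle k hk))))
  have h1 : RatModEqPow p 4
      (∑ k ∈ Finset.range (n + 1), (6 * (k : ℚ) + 1) *
        (shiftedFactorial (1 / 3) k / shiftedFactorial 1 k) ^ 2 *
        ∏ j ∈ Finset.range k,
          (((1 / 3 + j : ℚ) ^ 4 - (p / 3) ^ 4) / ((1 + j) ^ 4 - (p / 3) ^ 4)))
      (∑ k ∈ Finset.range (n + 1), (6 * (k : ℚ) + 1) *
        (shiftedFactorial (1 / 3) k / shiftedFactorial 1 k) ^ 6) := by
    refine RatModEqPow.sum' hp fun k hk => ?_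
    have h6 : (6 * (k : ℚ) + 1) ∈ pIntegers p hp :=
      add_mem (mul_mem (natCast_mem _ 6) (natCast_mem _ k)) (one_mem _)
    rw [show 6 = 2 + 4 by norm_num, pow_add, ← mul_assoc]
    exact (RatModEqPow.refl' hp 4 _).mul' (ratModEqPow_quartic_prod hp hn (hle k hk))
      (mul_mem h6 (pow_mem (hu k hk) 2)) (pow_mem (hu k hk) 4)
  rw [sum_quartic_eq hn] at h1
  refine h1.symm' hp |>.trans' hp ?_
  refine (RatModEqPow.refl' hp 4 _).mul' (hp := hp) ?_ (mul_mem hpm hR) (sum_mem fun k hk => ?_)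
  · refine RatModEqPow.sum' hp fun k hk => ?_
    rw [show 3 = 1 + 2 by norm_num, pow_add, pow_one, mul_assoc]
    exact (RatModEqPow.refl' hp 4 _).mul' (ratModEqPow_quadratic_prod hp hn (hle k hk))
      (hu k hk) (hmem k hk)
  · rw [show 3 = 1 + 2 by norm_num, pow_add, pow_one, mul_assoc]
    exact mul_mem (hu k hk) (hmem k hk)

/-! ### Cubing and the triple sum -/

/-- Put `S = pA + p ^ 4 e` with `A = R (T - p ^ 2 V)`. Every term of `S ^ 3` involving `e` is
divisible by `p ^ 6`, and the terms of `p ^ 3 A ^ 3` beyond first order in `V` by `p ^ 7`. -/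
lemma ratModEqPow_cube (hp : p.Prime) {S R T V : ℚ}
    (hR : R ∈ pIntegers p hp) (hT : T ∈ pIntegers p hp) (hV : V ∈ pIntegers p hp)
    (h : RatModEqPow p 4 S (p * R * (T - (p : ℚ) ^ 2 * V))) :
    RatModEqPow p 6 (S ^ 3) ((p : ℚ) ^ 3 * R ^ 3 * T ^ 2 * (T - 3 * (p : ℚ) ^ 2 * V)) := by
  obtain ⟨e, he, h⟩ := exists_mem_pIntegers hp h
  lift R to pIntegers p hp using hR
  lift T to pIntegers p hp using hT
  lift V to pIntegers p hp using hV
  lift e to pIntegers p hp using he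
  refine ⟨((3 * (R * (T - (p : pIntegers p hp) ^ 2 * V)) ^ 2 * e +
    3 * (R * (T - (p : pIntegers p hp) ^ 2 * V)) * (p : pIntegers p hp) ^ 3 * e ^ 2 +
    (p : pIntegers p hp) ^ 6 * e ^ 3 +
    R ^ 3 * (3 * T * p * V ^ 2 - (p : pIntegers p hp) ^ 3 * V ^ 3) : pIntegers p hp) : ℚ),
    Subtype.prop (p := (· ∈ pIntegers p hp)) _, ?_⟩
  have h3 : ((3 : pIntegers p hp) : ℚ) = 3 := rfl
  rw [sub_eq_iff_eq_add.1 h]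
  push_cast
  rw [h3]
  ring

lemma ratModEqPow_sum_simplex (hp : p.Prime) (hn : p = 3 * n + 1) :
    RatModEqPow p 6
      (∑ x ∈ (Finset.range p ×ˢ Finset.range p ×ˢ Finset.range p).filter
          (fun x : ℕ × ℕ × ℕ => x.1 + x.2.1 + x.2.2 ≤ p - 1),
        (6 * (x.1 : ℚ) + 1) * (6 * (x.2.1 : ℚ) + 1) * (6 * (x.2.2 : ℚ) + 1) *
          ((shiftedFactorial (1 / 3) x.1 ^ 6 * shiftedFactorial (1 / 3) x.2.1 ^ 6 *
              shiftedFactorial (1 / 3) x.2.2 ^ 6) /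
            (shiftedFactorial 1 x.1 ^ 6 * shiftedFactorial 1 x.2.1 ^ 6 *
              shiftedFactorial 1 x.2.2 ^ 6)))
      ((∑ k ∈ Finset.range (n + 1), (6 * (k : ℚ) + 1) *
        (shiftedFactorial (1 / 3) k / shiftedFactorial 1 k) ^ 6) ^ 3) := by
  set c : ℕ → ℚ := fun k => (6 * (k : ℚ) + 1) *
        (shiftedFactorial (1 / 3) k / shiftedFactorial 1 k) ^ 6 with hc
  have hcm : ∀ k < p, c k ∈ pIntegers p hp := fun k hk =>
    mul_mem (add_mem (mul_mem (natCast_mem _ 6) (natCast_mem _ k)) (one_mem _))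
      (pow_mem (third_div_mem_pIntegers hn hk) 6)
  have hc0 : ∀ k < p, n < k → RatModEqPow p 6 (c k) 0 := fun k hk hnk => by
    obtain ⟨d, hd, h⟩ := exists_mem_pIntegers hp (ratModEqPow_third_div_zero hp hn hnk hk)
    rw [sub_zero, pow_one] at h
    refine ratModEqPow_of_sub_eq (hp := hp) (mul_mem (add_mem (mul_mem (natCast_mem _ 6)
      (natCast_mem _ k)) (one_mem _)) (pow_mem hd 6)) ?_
    simp only [hc, h]
    push_cast
    ring
  have hterm : ∀ x : ℕ × ℕ × ℕ,
      (6 * (x.1 : ℚ) + 1) * (6 * (x.2.1 : ℚ) + 1) * (6 * (x.2.2 : ℚ) + 1) *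
          ((shiftedFactorial (1 / 3) x.1 ^ 6 * shiftedFactorial (1 / 3) x.2.1 ^ 6 *
              shiftedFactorial (1 / 3) x.2.2 ^ 6) /
            (shiftedFactorial 1 x.1 ^ 6 * shiftedFactorial 1 x.2.1 ^ 6 *
              shiftedFactorial 1 x.2.2 ^ 6)) = c x.1 * (c x.2.1 * c x.2.2) := fun x => by
    simp only [hc, mul_div_mul_comm, div_pow]
    ring
  have hcube : (∑ k ∈ Finset.range (n + 1), c k) ^ 3 =
      ∑ x ∈ Finset.range (n + 1) ×ˢ Finset.range (n + 1) ×ˢ Finset.range (n + 1),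
        c x.1 * (c x.2.1 * c x.2.2) := by
    rw [Finset.sum_product]
    simp only [Finset.sum_product, ← Finset.mul_sum, ← Finset.sum_mul]
    ring
  simp only [hterm]
  rw [hcube]
  set s := (Finset.range p ×ˢ Finset.range p ×ˢ Finset.range p).filter
          (fun x : ℕ × ℕ × ℕ => x.1 + x.2.1 + x.2.2 ≤ p - 1) with hs
  set t := Finset.range (n + 1) ×ˢ Finset.range (n + 1) ×ˢ Finset.range (n + 1) with ht
  -- Coordinates at most `n` have sum at most `3n = p - 1`.
  have hts : t ⊆ s := fun x hx => by
    simp only [hs, ht, Finset.mem_filter, Finset.mem_product, Finset.mem_range] at hx ⊢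
    omega
  rw [← Finset.sum_sdiff hts]
  -- Outside the box some coordinate exceeds `n`, and its factor alone is `0` mod `p ^ 6`.
  have hrest : RatModEqPow p 6 (∑ x ∈ s \ t, c x.1 * (c x.2.1 * c x.2.2)) (∑ x ∈ s \ t, 0) := by
    refine RatModEqPow.sum' hp fun x hx => ?_
    simp only [hs, ht, Finset.mem_sdiff, Finset.mem_filter, Finset.mem_product,
      Finset.mem_range] at hx
    obtain ⟨⟨⟨h1, h2, h3⟩, -⟩, hx⟩ := hx
    have m1 := hcm _ h1
    have m2 := hcm _ h2
    have m3 := hcm _ h3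
    by_cases g1 : n < x.1
    · simpa using (hc0 _ h1 g1).mul' (RatModEqPow.refl' hp 6 (c x.2.1 * c x.2.2)) (zero_mem _)
        (mul_mem m2 m3)
    by_cases g2 : n < x.2.1
    · simpa using (RatModEqPow.refl' hp 6 (c x.1)).mul'
        ((hc0 _ h2 g2).mul' (RatModEqPow.refl' hp 6 (c x.2.2)) (zero_mem _) m3) m1
        (by simp)
    · have g3 : n < x.2.2 := by omega
      simpa using (RatModEqPow.refl' hp 6 (c x.1)).mul'
        ((RatModEqPow.refl' hp 6 (c x.2.1)).mul' (hc0 _ h3 g3) m2 (zero_mem _)) m1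
        (by simp)
  obtain ⟨d, hd, h⟩ := hrest
  refine ⟨d, hd, ?_⟩
  rw [Finset.sum_const_zero] at h
  linear_combination h

end

lemma sum_mul_one_sub_mul {ι : Type*} (s : Finset ι) (f g : ι → ℚ) (c : ℚ) :
    ∑ i ∈ s, f i * (1 - c * g i) = ∑ i ∈ s, f i - c * ∑ i ∈ s, f i * g i := by
  rw [Finset.mul_sum, ← Finset.sum_sub_distrib]
  exact Finset.sum_congr rfl fun i _ => by ring

theorem mainTheorem11 (p : ℕ) (hp : p.Prime) (hp6 : p ≡ 1 [MOD 6]) :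
    RatModEqPow p 6
      (∑ x ∈ (Finset.range p ×ˢ Finset.range p ×ˢ Finset.range p).filter
          (fun x : ℕ × ℕ × ℕ => x.1 + x.2.1 + x.2.2 ≤ p - 1),
        (6 * (x.1 : ℚ) + 1) * (6 * (x.2.1 : ℚ) + 1) * (6 * (x.2.2 : ℚ) + 1) *
          ((shiftedFactorial (1 / 3) x.1 ^ 6 * shiftedFactorial (1 / 3) x.2.1 ^ 6 *
              shiftedFactorial (1 / 3) x.2.2 ^ 6) /
            (shiftedFactorial 1 x.1 ^ 6 * shiftedFactorial 1 x.2.1 ^ 6 *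
              shiftedFactorial 1 x.2.2 ^ 6)))
      ((p : ℚ) ^ 3 *
        (shiftedFactorial (2 / 3) ((p - 1) / 3) ^ 3 / shiftedFactorial 1 ((p - 1) / 3) ^ 3) *
        (∑ k ∈ Finset.range ((p - 1) / 3 + 1),
          shiftedFactorial (1 / 3) k ^ 3 / shiftedFactorial 1 k ^ 3) ^ 2 *
        ∑ k ∈ Finset.range ((p - 1) / 3 + 1),
          shiftedFactorial (1 / 3) k ^ 3 / shiftedFactorial 1 k ^ 3 *
            (1 - 3 * (p : ℚ) ^ 2 *
              ∑ t ∈ Finset.Icc 1 k,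
                (1 / (3 * (t : ℚ) - 2) ^ 2 + 1 / (3 * (t : ℚ)) ^ 2))) := by
  have hn : p = 3 * ((p - 1) / 3) + 1 := by
    have := hp.pos
    unfold Nat.ModEq at hp6
    omega
  generalize (p - 1) / 3 = n at *
  have hlt : ∀ k ∈ Finset.range (n + 1), k < p ∧ k ≤ n := fun k hk => by
    have := Finset.mem_range.1 hk
    omega
  have h := ratModEqPow_sum_third_pow_six hp hn
  -- This gives the shape `T - p ^ 2 V` required by `ratModEqPow_cube`.
  rw [sum_mul_one_sub_mul] at h
  have hR : shiftedFactorial (2 / 3) n / shiftedFactorial 1 n ∈ pIntegers p hp := by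
    simpa using shiftedFactorial_div_mem_pIntegers (hp := hp) hn 2 (show n < p by omega)
  have key := (ratModEqPow_sum_simplex hp hn).trans' hp (ratModEqPow_cube hp hR
    (sum_mem fun k hk => pow_mem (third_div_mem_pIntegers hn (hlt k hk).1) 3)
    (sum_mem fun k hk => mul_mem (pow_mem (third_div_mem_pIntegers hn (hlt k hk).1) 3)
      (sum_inv_sq_mem_pIntegers hp hn (hlt k hk).2)) h)
  simpa only [div_pow, sum_mul_one_sub_mul] using key
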